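/- Let $1\le k\le n$. Let $\mathbb{O}^{n\times k}=\{P\in\mathbb{R}^{n\times k}:P^{\rm T}P=I_k\}$, let $\|\cdot\|$ be a matrix norm on $\mathbb{R}^{k\times k}$, let $\delta>0$, and let $f$ be a real-valued function that is differentiable on $\mathbb{O}^{n\times k}_\delta=\{P\in\mathbb{R}^{n\times k}:\|P^{\rm T}P-I_k\|<\delta\}$ and whose Euclidean gradient $\mathscr{H}(P)=\big[\partial f(P)/\partial p_{ij}\big]\in\mathbb{R}^{n\times k}$ is continuous on $\mathbb{O}^{n\times k}$. Write $\mathcal{R}(P)$ for the column space of $P$. Suppose that the NPDo Ansatz holds on a subset $\mathbb{P}\subseteq\mathbb{O}^{n\times k}$ with a constant $\omega>0$: whenever $P\in\mathbb{P}$, $\widehat P\in\mathbb{O}^{n\times k}$ and $\eta\in\mathbb{R}$ satisfy $$\operatorname{tr}(\widehat P^{\rm T}\mathscr{H}(P))\ge\operatorname{tr}(P^{\rm T}\mathscr{H}(P))+\eta,\qquad(*)$$ there is $Q\in\mathbb{O}^{k\times k}$ such that $\widetilde P=\widehat PQ\in\mathbb{P}$ and $f(\widetilde P)\ge f(P)+\omega\eta$.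 Let $\{P^{(i)}\}_{i=0}^\infty$ be generated by the NPDoSCF iteration: $P^{(0)}\in\mathbb{P}$ and, for $i=0,1,\dots$, $\mathscr{H}(P^{(i)})=U_i\Sigma_iV_i^{\rm T}$ is a thin singular value decomposition, $\widehat P^{(i)}=U_iV_i^{\rm T}$, and $P^{(i+1)}=\widehat P^{(i)}Q_i\in\mathbb{P}$, where $Q_i\in\mathbb{O}^{k\times k}$ is as provided by the Ansatz, i.e. $f(P^{(i+1)})\ge f(P^{(i)})+\omega\eta$ for every $\eta$ that satisfies $(*)$ with $P=P^{(i)}$ and $\widehat P=\widehat P^{(i)}$. Let $P_*$ be an accumulation point of $\{P^{(i)}\}_{i=0}^\infty$. The Grassmannian of $k$-dimensional subspaces of $\mathbb{R}^n$ carries the metric $\operatorname{dist}_2(\mathcal{R}(X),\mathcal{R}(Y))=\|\sin\Theta\|_2$ for $X,Y\in\mathbb{O}^{n\times k}$, where $\Theta$ is the diagonal matrix of the canonical angles $\arccos\sigma_i(X^{\rm T}Y)$. An accumulation point of a sequence is isolated if it has a neighborhood that contains no other accumulation point of the sequence. Then: (a) $\mathcal{R}(P_*)$ is an accumulation point of $\{\mathcal{R}(P^{(i)})\}_{i=0}^\infty$.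 (b) If $\mathcal{R}(P_*)$ is an isolated accumulation point of $\{\mathcal{R}(P^{(i)})\}_{i=0}^\infty$ and $\operatorname{rank}(\mathscr{H}(P_*Q))=k$ for all $Q\in\mathbb{O}^{k\times k}$, then the entire sequence $\{\mathcal{R}(P^{(i)})\}_{i=0}^\infty$ converges to $\mathcal{R}(P_*)$. (c) If $P_*$ is an isolated accumulation point of $\{P^{(i)}\}_{i=0}^\infty$, $\operatorname{rank}(\mathscr{H}(P_*))=k$, and $f(P_*)>f(P)$ for every $P\in\mathbb{O}^{n\times k}$ with $P\ne P_*$ and $\mathcal{R}(P)=\mathcal{R}(P_*)$, then the entire sequence $\{P^{(i)}\}_{i=0}^\infty$ converges to $P_*$. -/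

import Mathlib

open Filter Topology Matrix

namespace NPDo

/-- The Stiefel manifold: real `n × k` matrices with orthonormal columns
(for `n = k` these are the orthogonal matrices). -/
def stiefel (n k : ℕ) : Set (Matrix (Fin n) (Fin k) ℝ) := {P | Pᵀ * P = 1}

/-- The neighborhood of the Stiefel manifold of those matrices `P` for which `PᵀP - I` has
size less than `δ` in the matrix norm `ν`. -/
def stiefelNhd (n : ℕ) {k : ℕ} (ν : Seminorm ℝ (Matrix (Fin k) (Fin k) ℝ)) (δ : ℝ) :
    Set (Matrix (Fin n) (Fin k) ℝ) := {P | ν (Pᵀ * P - 1) < δ}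

/-- The Euclidean gradient: the matrix of partial derivatives `∂f / ∂p_ij` at `P`. -/
noncomputable def gradient {n k : ℕ} (f : Matrix (Fin n) (Fin k) ℝ → ℝ)
    (P : Matrix (Fin n) (Fin k) ℝ) : Matrix (Fin n) (Fin k) ℝ :=
  Matrix.of fun i j => lineDeriv ℝ f P (Matrix.single i j 1)

/-- The NPDo Ansatz for `f` on the subset `S` of the Stiefel manifold, with constant `ω`. -/
def Ansatz {n k : ℕ} (f : Matrix (Fin n) (Fin k) ℝ → ℝ) (S : Set (stiefel n k)) (ω : ℝ) : Prop :=
  ∀ P ∈ S, ∀ Phat : stiefel n k, ∀ η : ℝ,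
    (Phat.1ᵀ * gradient f P).trace ≥ (P.1ᵀ * gradient f P).trace + η →
      ∃ Q ∈ stiefel k k, ∃ Ptilde ∈ S, Ptilde.1 = Phat.1 * Q ∧ f Ptilde ≥ f P + ω * η

/-- `B = U Σ Vᵀ` is a thin singular value decomposition of `B`, where `Σ = diag σ`. -/
structure IsThinSVD {n k : ℕ} (B U : Matrix (Fin n) (Fin k) ℝ) (σ : Fin k → ℝ)
    (V : Matrix (Fin k) (Fin k) ℝ) : Prop where
  left_mem : U ∈ stiefel n k
  right_mem : V ∈ stiefel k k
  antitone : Antitone σ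
  nonneg : ∀ j, 0 ≤ σ j
  eq : B = U * Matrix.diagonal σ * Vᵀ

/-- One step of the NPDoSCF iteration from `P` to `P'`: take a thin SVD `U Σ Vᵀ` of the gradient
at `P`, the orthogonal polar factor `Phat = U Vᵀ`, and `P' = Phat Q`, where `Q` is an orthogonal
matrix as stipulated by the Ansatz for the pair `P`, `Phat`. -/
def IsSCFStep {n k : ℕ} (f : Matrix (Fin n) (Fin k) ℝ → ℝ) (S : Set (stiefel n k)) (ω : ℝ)
    (P P' : stiefel n k) : Prop :=
  ∃ (U : Matrix (Fin n) (Fin k) ℝ) (σ : Fin k → ℝ) (V Q : Matrix (Fin k) (Fin k) ℝ),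
    IsThinSVD (gradient f P) U σ V ∧ Q ∈ stiefel k k ∧ P'.1 = U * Vᵀ * Q ∧ P' ∈ S ∧
      ∀ η : ℝ, ((U * Vᵀ)ᵀ * gradient f P).trace ≥ (P.1ᵀ * gradient f P).trace + η →
        f P' ≥ f P + ω * η

/-- The sequence `P` is generated by the NPDoSCF iteration. -/
structure IsSCFSequence {n k : ℕ} (f : Matrix (Fin n) (Fin k) ℝ → ℝ) (S : Set (stiefel n k))
    (ω : ℝ) (P : ℕ → stiefel n k) : Prop where
  init : P 0 ∈ S
  step : ∀ i, IsSCFStep f S ω (P i) (P (i + 1))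

/-- The Grassmann manifold of `k`-dimensional subspaces of `ℝⁿ`. -/
def Grassmannian (n k : ℕ) : Type :=
  {T : Submodule ℝ (EuclideanSpace ℝ (Fin n)) // Module.finrank ℝ T = k}

/-- The column space of a matrix. -/
noncomputable def colSpace {n k : ℕ} (X : Matrix (Fin n) (Fin k) ℝ) :
    Submodule ℝ (EuclideanSpace ℝ (Fin n)) :=
  LinearMap.range (Matrix.toEuclideanLin X)

theorem toEuclideanLin_mul {l m n : ℕ} (A : Matrix (Fin l) (Fin m) ℝ)
    (B : Matrix (Fin m) (Fin n) ℝ) (v : EuclideanSpace ℝ (Fin n)) :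
    Matrix.toEuclideanLin (A * B) v = Matrix.toEuclideanLin A (Matrix.toEuclideanLin B v) := by
  simp [Matrix.toLpLin_apply, Matrix.mulVec_mulVec]

theorem inner_toEuclideanLin_left {m n : ℕ} (A : Matrix (Fin m) (Fin n) ℝ)
    (v : EuclideanSpace ℝ (Fin n)) (w : EuclideanSpace ℝ (Fin m)) :
    inner ℝ (Matrix.toEuclideanLin A v) w = inner ℝ v (Matrix.toEuclideanLin Aᵀ w) := by
  have h := Matrix.toEuclideanLin_conjTranspose_eq_adjoint A
  rw [Matrix.conjTranspose_eq_transpose_of_trivial] at h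
  rw [h, LinearMap.adjoint_inner_right]

theorem inner_toEuclideanLin {n k : ℕ} {X : Matrix (Fin n) (Fin k) ℝ} (hX : X ∈ stiefel n k)
    (v w : EuclideanSpace ℝ (Fin k)) :
    inner ℝ (Matrix.toEuclideanLin X v) (Matrix.toEuclideanLin X w) = inner ℝ v w := by
  rw [inner_toEuclideanLin_left, ← toEuclideanLin_mul, show Xᵀ * X = 1 from hX]
  simp

theorem norm_toEuclideanLin {n k : ℕ} {X : Matrix (Fin n) (Fin k) ℝ} (hX : X ∈ stiefel n k)
    (v : EuclideanSpace ℝ (Fin k)) : ‖Matrix.toEuclideanLin X v‖ = ‖v‖ := by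
  rw [@norm_eq_sqrt_real_inner _ _ _ (Matrix.toEuclideanLin X v), @norm_eq_sqrt_real_inner _ _ _ v,
    inner_toEuclideanLin hX]

theorem finrank_colSpace {n k : ℕ} {X : Matrix (Fin n) (Fin k) ℝ} (hX : X ∈ stiefel n k) :
    Module.finrank ℝ (colSpace X) = k := by
  have h : Function.Injective (Matrix.toEuclideanLin X) := by
    rw [injective_iff_map_eq_zero]
    intro v hv
    rw [← norm_eq_zero, ← norm_toEuclideanLin hX, hv, norm_zero]
  rw [colSpace, LinearMap.finrank_range_of_inj h, finrank_euclideanSpace, Fintype.card_fin]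

/-- The column space of a matrix with orthonormal columns, as a point of the Grassmannian. -/
noncomputable def colSpan {n k : ℕ} (P : stiefel n k) : Grassmannian n k :=
  ⟨colSpace P.1, finrank_colSpace P.2⟩

theorem colSpan_surjective {n k : ℕ} (T : Grassmannian n k) : ∃ X : stiefel n k, colSpan X = T := by
  let b : OrthonormalBasis (Fin k) ℝ T.1 := (stdOrthonormalBasis ℝ T.1).reindex (finCongr T.2)
  let X : Matrix (Fin n) (Fin k) ℝ := Matrix.of fun i j => (b j : EuclideanSpace ℝ (Fin n)) i
  have hX : X ∈ stiefel n k := by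
    change Xᵀ * X = 1
    ext i j
    have h := orthonormal_iff_ite.1 b.orthonormal i j
    rw [Submodule.coe_inner, PiLp.inner_apply] at h
    rw [Matrix.one_apply, ← h, Matrix.mul_apply]
    refine Finset.sum_congr rfl fun l _ => ?_
    exact mul_comm _ _
  refine ⟨⟨X, hX⟩, Subtype.ext ?_⟩
  refine Submodule.eq_of_le_of_finrank_eq ?_ ((finrank_colSpace hX).trans T.2.symm)
  rintro _ ⟨v, rfl⟩
  have h : Matrix.toEuclideanLin X v = ((∑ j, v j • b j : T.1) : EuclideanSpace ℝ (Fin n)) := by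
    ext i
    have h1 : (Matrix.toEuclideanLin X v) i =
        ∑ j, (b j : EuclideanSpace ℝ (Fin n)) i * v j := rfl
    rw [h1]
    simp only [Submodule.coe_sum, Submodule.coe_smul, WithLp.ofLp_sum, Finset.sum_apply,
      PiLp.smul_apply, smul_eq_mul]
    exact Finset.sum_congr rfl fun j _ => mul_comm _ _
  rw [h]
  exact Subtype.property _

/-- An orthonormal basis matrix of a subspace. -/
noncomputable def basisMatrix {n k : ℕ} (T : Grassmannian n k) : stiefel n k :=
  (colSpan_surjective T).choose

/-- The canonical angles `arccos σ_i(XᵀY)` between the column spaces of two matrices `X` and `Y`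
with orthonormal columns (in increasing order). -/
noncomputable def canonicalAngles {n k : ℕ} (X Y : stiefel n k) (i : Fin k) : ℝ :=
  Real.arccos ((Matrix.toEuclideanLin (X.1ᵀ * Y.1)).singularValues i)

open scoped Matrix.Norms.L2Operator in
/-- The spectral norm of `sin Θ`, where `Θ` is the diagonal matrix of the canonical angles. -/
noncomputable def sinThetaNorm {n k : ℕ} (X Y : stiefel n k) : ℝ :=
  ‖Matrix.diagonal fun i => Real.sin (canonicalAngles X Y i)‖

open scoped Matrix.Norms.L2Operator in
theorem sinThetaNorm_nonneg {n k : ℕ} (X Y : stiefel n k) : 0 ≤ sinThetaNorm X Y :=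
  norm_nonneg _

theorem norm_sq_eq_sum {k : ℕ} (A : Matrix (Fin k) (Fin k) ℝ) :
    ∃ b : OrthonormalBasis (Fin k) ℝ (EuclideanSpace ℝ (Fin k)),
      ∀ v, ‖Matrix.toEuclideanLin A v‖ ^ 2 =
        ∑ i : Fin k, (Matrix.toEuclideanLin A).singularValues i ^ 2 * (inner ℝ (b i) v) ^ 2 := by
  have hk : Module.finrank ℝ (EuclideanSpace ℝ (Fin k)) = k := by simp
  let T := Matrix.toEuclideanLin A
  let hT := T.isSymmetric_adjoint_comp_self
  refine ⟨hT.eigenvectorBasis hk, fun v => ?_⟩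
  have h1 : ‖T v‖ ^ 2 = inner ℝ ((LinearMap.adjoint T ∘ₗ T) v) v := by
    rw [LinearMap.comp_apply, LinearMap.adjoint_inner_left, real_inner_self_eq_norm_sq]
  rw [h1, ← (hT.eigenvectorBasis hk).sum_inner_mul_inner]
  refine Finset.sum_congr rfl fun i _ => ?_
  have h2 : inner ℝ ((LinearMap.adjoint T ∘ₗ T) v) (hT.eigenvectorBasis hk i) =
      hT.eigenvalues hk i * inner ℝ (hT.eigenvectorBasis hk i) v := by
    rw [hT, hT.apply_eigenvectorBasis, inner_smul_right, real_inner_comm]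
    rfl
  rw [h2, ← T.sq_singularValues_fin hk]
  ring

theorem sinThetaNorm_le_iff {n k : ℕ} (X Y : stiefel n k) {c : ℝ} (hc : 0 ≤ c) :
    sinThetaNorm X Y ≤ c ↔
      ∀ v, ‖v‖ ^ 2 ≤ ‖Matrix.toEuclideanLin (X.1ᵀ * Y.1) v‖ ^ 2 + c ^ 2 * ‖v‖ ^ 2 := by
  obtain ⟨b, hb⟩ := norm_sq_eq_sum (X.1ᵀ * Y.1)
  have hle : sinThetaNorm X Y ≤ c ↔
      ∀ i : Fin k, 1 ≤ (Matrix.toEuclideanLin (X.1ᵀ * Y.1)).singularValues i ^ 2 + c ^ 2 := by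
    rw [sinThetaNorm, Matrix.l2_opNorm_diagonal, pi_norm_le_iff_of_nonneg hc]
    refine forall_congr' fun i => ?_
    rw [canonicalAngles, Real.sin_arccos, Real.norm_of_nonneg (Real.sqrt_nonneg _),
      Real.sqrt_le_left hc, sub_le_iff_le_add']
  rw [hle]
  constructor
  · intro h v
    have hv : ‖v‖ ^ 2 = ∑ i, (inner ℝ (b i) v) ^ 2 := by
      rw [← b.sum_sq_norm_inner_right v]
      simp
    rw [hb v, hv, Finset.mul_sum, ← Finset.sum_add_distrib]
    refine Finset.sum_le_sum fun i _ => ?_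
    nlinarith [h i, sq_nonneg (inner ℝ (b i) v)]
  · intro h i
    have h1 := h (b i)
    rw [hb] at h1
    have h2 : ∀ j, (inner ℝ (b j) (b i)) ^ 2 = if j = i then (1 : ℝ) else 0 := by
      intro j
      rw [orthonormal_iff_ite.1 b.orthonormal j i]
      split_ifs <;> simp
    simpa [h2] using h1

/-- The norm of `sin Θ` as a gap between the column spaces. -/
theorem sinThetaNorm_le_iff_gap {n k : ℕ} (X Y : stiefel n k) {c : ℝ} (hc : 0 ≤ c) :
    sinThetaNorm X Y ≤ c ↔
      ∀ y ∈ colSpace Y.1, ∃ x ∈ colSpace X.1, ‖y - x‖ ≤ c * ‖y‖ ∧ ‖x‖ ≤ ‖y‖ := by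
  rw [sinThetaNorm_le_iff X Y hc]
  have key : ∀ v w, ‖Matrix.toEuclideanLin Y.1 v - Matrix.toEuclideanLin X.1 w‖ ^ 2 =
      ‖v‖ ^ 2 - 2 * inner ℝ (Matrix.toEuclideanLin (X.1ᵀ * Y.1) v) w + ‖w‖ ^ 2 := by
    intro v w
    rw [@norm_sub_sq_real, norm_toEuclideanLin Y.2, norm_toEuclideanLin X.2, toEuclideanLin_mul,
      inner_toEuclideanLin_left X.1ᵀ, Matrix.transpose_transpose]
  constructor
  · rintro h _ ⟨v, rfl⟩
    set u := Matrix.toEuclideanLin (X.1ᵀ * Y.1) v with hu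
    have hk := key v u
    rw [← hu, real_inner_self_eq_norm_sq] at hk
    refine ⟨Matrix.toEuclideanLin X.1 u, ⟨u, rfl⟩, ?_, ?_⟩
    · rw [norm_toEuclideanLin Y.2]
      refine (sq_le_sq₀ (norm_nonneg _) (by positivity)).1 ?_
      nlinarith [h v]
    · rw [norm_toEuclideanLin X.2, norm_toEuclideanLin Y.2]
      refine (sq_le_sq₀ (norm_nonneg _) (norm_nonneg _)).1 ?_
      nlinarith [sq_nonneg ‖Matrix.toEuclideanLin Y.1 v - Matrix.toEuclideanLin X.1 u‖]
  · intro h v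
    obtain ⟨_, ⟨w, rfl⟩, h1, -⟩ := h _ ⟨v, rfl⟩
    rw [norm_toEuclideanLin Y.2] at h1
    have h2 := (sq_le_sq₀ (norm_nonneg _) (by positivity)).2 h1
    rw [key, mul_pow] at h2
    have h3 := sq_nonneg ‖Matrix.toEuclideanLin (X.1ᵀ * Y.1) v - w‖
    rw [@norm_sub_sq_real] at h3
    linarith

theorem sinThetaNorm_le_symm {n k : ℕ} (X Y : stiefel n k) : sinThetaNorm Y X ≤ sinThetaNorm X Y := by
  have h0 := sinThetaNorm_nonneg X Y
  have h := (sinThetaNorm_le_iff X Y h0).1 le_rfl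
  rw [sinThetaNorm_le_iff Y X h0]
  generalize sinThetaNorm X Y = c at h h0
  intro w
  rcases le_or_gt 1 c with hc | hc
  · have : 1 ≤ c ^ 2 := by nlinarith
    nlinarith [sq_nonneg ‖w‖, sq_nonneg ‖Matrix.toEuclideanLin (Y.1ᵀ * X.1) w‖]
  · have hc2 : c ^ 2 < 1 := by nlinarith
    have hinj : Function.Injective (Matrix.toEuclideanLin (X.1ᵀ * Y.1)) := by
      rw [injective_iff_map_eq_zero]
      intro v hv
      have h1 := h v
      rw [hv, norm_zero] at h1
      have : ‖v‖ ^ 2 ≤ 0 := by nlinarith [sq_nonneg ‖v‖]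
      have : ‖v‖ = 0 := by nlinarith [sq_nonneg ‖v‖]
      exact norm_eq_zero.1 this
    obtain ⟨v, rfl⟩ := LinearMap.injective_iff_surjective.1 hinj w
    have h1 := h v
    set A := X.1ᵀ * Y.1 with hA
    have hAt : Y.1ᵀ * X.1 = Aᵀ := by simp [hA]
    rw [hAt]
    set w := Matrix.toEuclideanLin A v with hw
    set z := Matrix.toEuclideanLin Aᵀ w with hz
    have h2 : ‖w‖ ^ 2 ≤ ‖v‖ * ‖z‖ := by
      rw [← real_inner_self_eq_norm_sq, hw, inner_toEuclideanLin_left, ← hw, ← hz]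
      exact real_inner_le_norm _ _
    rcases eq_or_lt_of_le (norm_nonneg v) with h3 | h3
    · have : ‖w‖ ^ 2 ≤ 0 := by rw [← h3] at h2; simpa using h2
      nlinarith [sq_nonneg ‖w‖, sq_nonneg ‖z‖]
    · have h4 : ‖w‖ ^ 2 * ‖w‖ ^ 2 ≤ ‖v‖ ^ 2 * ‖z‖ ^ 2 := by
        have := mul_le_mul h2 h2 (sq_nonneg _) (by positivity)
        linarith [this, show ‖v‖ * ‖z‖ * (‖v‖ * ‖z‖) = ‖v‖ ^ 2 * ‖z‖ ^ 2 by ring]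
      have h5 : (1 - c ^ 2) * ‖w‖ ^ 2 * ‖v‖ ^ 2 ≤ ‖w‖ ^ 2 * ‖w‖ ^ 2 := by
        nlinarith [sq_nonneg ‖w‖]
      have h6 : ‖v‖ ^ 2 * ((1 - c ^ 2) * ‖w‖ ^ 2) ≤ ‖v‖ ^ 2 * ‖z‖ ^ 2 := by linarith
      have := le_of_mul_le_mul_left h6 (by positivity)
      linarith

theorem sinThetaNorm_congr {n k : ℕ} {X Y X' Y' : stiefel n k} (hX : colSpan X = colSpan X')
    (hY : colSpan Y = colSpan Y') : sinThetaNorm X Y = sinThetaNorm X' Y' := by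
  have hX' : colSpace X.1 = colSpace X'.1 := congrArg Subtype.val hX
  have hY' : colSpace Y.1 = colSpace Y'.1 := congrArg Subtype.val hY
  refine le_antisymm ?_ ?_
  · rw [sinThetaNorm_le_iff_gap _ _ (sinThetaNorm_nonneg _ _), hX', hY',
      ← sinThetaNorm_le_iff_gap _ _ (sinThetaNorm_nonneg _ _)]
  · rw [sinThetaNorm_le_iff_gap _ _ (sinThetaNorm_nonneg _ _), ← hX', ← hY',
      ← sinThetaNorm_le_iff_gap _ _ (sinThetaNorm_nonneg _ _)]

theorem colSpan_basisMatrix {n k : ℕ} (T : Grassmannian n k) : colSpan (basisMatrix T) = T :=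
  (colSpan_surjective T).choose_spec

/-- The metric `‖sin Θ(T₁, T₂)‖₂` on the Grassmannian, where `Θ` is the diagonal matrix of the
canonical angles. -/
noncomputable instance (n k : ℕ) : MetricSpace (Grassmannian n k) where
  dist T₁ T₂ := sinThetaNorm (basisMatrix T₁) (basisMatrix T₂)
  dist_self T := by
    refine le_antisymm ?_ (sinThetaNorm_nonneg _ _)
    rw [sinThetaNorm_le_iff_gap _ _ le_rfl]
    exact fun y hy => ⟨y, hy, by simp, le_rfl⟩
  dist_comm T₁ T₂ := le_antisymm (sinThetaNorm_le_symm _ _) (sinThetaNorm_le_symm _ _)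
  dist_triangle T₁ T₂ T₃ := by
    have h1 := sinThetaNorm_nonneg (basisMatrix T₁) (basisMatrix T₂)
    have h2 := sinThetaNorm_nonneg (basisMatrix T₂) (basisMatrix T₃)
    have g1 := (sinThetaNorm_le_iff_gap _ _ h1).1 le_rfl
    have g2 := (sinThetaNorm_le_iff_gap _ _ h2).1 le_rfl
    have h12 := add_nonneg h1 h2
    generalize sinThetaNorm (basisMatrix T₁) (basisMatrix T₂) = c₁ at *
    generalize sinThetaNorm (basisMatrix T₂) (basisMatrix T₃) = c₂ at *
    rw [sinThetaNorm_le_iff_gap _ _ h12]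
    intro y hy
    obtain ⟨s, hs, h3, h4⟩ := g2 y hy
    obtain ⟨r, hr, h5, h6⟩ := g1 s hs
    refine ⟨r, hr, ?_, h6.trans h4⟩
    calc ‖y - r‖ ≤ ‖y - s‖ + ‖s - r‖ := norm_sub_le_norm_sub_add_norm_sub _ _ _
      _ ≤ c₂ * ‖y‖ + c₁ * ‖s‖ := add_le_add h3 h5
      _ ≤ c₂ * ‖y‖ + c₁ * ‖y‖ := by gcongr
      _ = (c₁ + c₂) * ‖y‖ := by ring
  eq_of_dist_eq_zero {T₁ T₂} h := by
    have g := (sinThetaNorm_le_iff_gap _ _ le_rfl).1 (le_of_eq h)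
    have hle : T₂.1 ≤ T₁.1 := by
      intro y hy
      rw [← colSpan_basisMatrix T₂] at hy
      obtain ⟨x, hx, h1, -⟩ := g y hy
      rw [zero_mul, norm_le_zero_iff, sub_eq_zero] at h1
      rw [h1, ← colSpan_basisMatrix T₁]
      exact hx
    exact Subtype.ext (Submodule.eq_of_le_of_finrank_eq hle (T₂.2.trans T₁.2.symm)).symm

/-- The metric is computed from arbitrary orthonormal basis matrices. -/
theorem dist_colSpan {n k : ℕ} (X Y : stiefel n k) :
    dist (colSpan X) (colSpan Y) = sinThetaNorm X Y :=
  sinThetaNorm_congr (colSpan_basisMatrix _) (colSpan_basisMatrix _)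

/-- `a` is an isolated accumulation point of the sequence `u`: it is an accumulation point, and
some neighborhood of `a` contains no other accumulation point of `u`. -/
def IsIsolatedAccPt {α : Type*} [TopologicalSpace α] (u : ℕ → α) (a : α) : Prop :=
  MapClusterPt a atTop u ∧ ∃ N ∈ 𝓝 a, ∀ b ∈ N, MapClusterPt b atTop u → b = a

end NPDo

namespace NPDo

/-! The polar factor `U * Vᵀ` maximizes the trace against the gradient, so the gap in `(*)` is
nonnegative and `f` increases along the iteration. As `f` is bounded on the compact Stiefel
manifold, its values converge and the gaps, bounded by the increments of `f` over `ω`, tend to zero.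
If iterates tend to `X` along an ultrafilter, so do their SVD factors to an SVD at `X`, and `X`
attains the maximal trace there. Full rank makes the maximizer unique (`eq_polar`), so `X` is the
limit polar factor and the next iterates tend to `X * Q'`, with the same column space
(`exists_tendsto_succ`). Thus consecutive column spaces have a common limit, and a sequence in a
compact space with this property near an isolated accumulation point converges to it. For (c), `X *
Q'` and `X` share the limit value of `f`, so strict maximality forces them to agree. -/

/-! ### Trace maximization by the polar factor -/

/-- The gap is the sum of `σ j * (1 - ⟨a_j, u_j⟩)` over the columns of `P * V` and `U`; these are
unit vectors, so each bracket is half a squared distance. Both nonnegativity and the equality case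
are then visible. -/
theorem IsThinSVD.trace_gap {n k : ℕ} {B U : Matrix (Fin n) (Fin k) ℝ} {σ : Fin k → ℝ}
    {V : Matrix (Fin k) (Fin k) ℝ} (h : IsThinSVD B U σ V) (P : stiefel n k) :
    ((U * Vᵀ)ᵀ * B).trace - (P.1ᵀ * B).trace =
      2⁻¹ * ∑ j, σ j * ∑ i, ((P.1 * V) i j - U i j) ^ 2 := by
  have hU : Uᵀ * U = 1 := h.left_mem
  have hV : Vᵀ * V = 1 := h.right_mem
  have hA : (P.1 * V)ᵀ * (P.1 * V) = 1 := by
    rw [transpose_mul, Matrix.mul_assoc, ← Matrix.mul_assoc P.1ᵀ, show P.1ᵀ * P.1 = 1 from P.2,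
      Matrix.one_mul, hV]
  have h1 : ((U * Vᵀ)ᵀ * B).trace = ∑ j, σ j := by
    rw [h.eq, transpose_mul, transpose_transpose, Matrix.mul_assoc V, Matrix.trace_mul_comm,
      Matrix.mul_assoc, Matrix.mul_assoc, hV, Matrix.mul_one, ← Matrix.mul_assoc, hU,
      Matrix.one_mul, Matrix.trace_diagonal]
  have h2 : (P.1ᵀ * B).trace = ∑ j, ((P.1 * V)ᵀ * U) j j * σ j := by
    rw [h.eq, ← Matrix.mul_assoc, Matrix.trace_mul_comm, ← Matrix.mul_assoc, ← Matrix.mul_assoc,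
      ← transpose_mul, Matrix.trace]
    simp only [Matrix.diag_apply, Matrix.mul_diagonal]
  rw [h1, h2, ← Finset.sum_sub_distrib, Finset.mul_sum]
  refine Finset.sum_congr rfl fun j _ => ?_
  generalize P.1 * V = A at hA ⊢
  have e1 : ∑ i, A i j * A i j = 1 := by simpa [Matrix.mul_apply] using congrFun₂ hA j j
  have e2 : ∑ i, U i j * U i j = 1 := by simpa [Matrix.mul_apply] using congrFun₂ hU j j
  have e3 : ∑ i, (A i j - U i j) ^ 2 = 2 - 2 * (Aᵀ * U) j j := by
    have : ∀ i, (A i j - U i j) ^ 2 = A i j * A i j + U i j * U i j - 2 * (A i j * U i j) :=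
      fun i => by ring
    simp only [this, Finset.sum_sub_distrib, Finset.sum_add_distrib, e1, e2, ← Finset.mul_sum,
      Matrix.mul_apply, transpose_apply]
    ring
  rw [e3]
  ring

theorem IsThinSVD.trace_gap_nonneg {n k : ℕ} {B U : Matrix (Fin n) (Fin k) ℝ} {σ : Fin k → ℝ}
    {V : Matrix (Fin k) (Fin k) ℝ} (h : IsThinSVD B U σ V) (P : stiefel n k) :
    0 ≤ ((U * Vᵀ)ᵀ * B).trace - (P.1ᵀ * B).trace := by
  rw [h.trace_gap]
  exact mul_nonneg (by norm_num) (Finset.sum_nonneg fun j _ =>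
    mul_nonneg (h.nonneg j) (Finset.sum_nonneg fun i _ => sq_nonneg _))

/-- The trace inner product with a matrix of full column rank is maximized over the Stiefel
manifold only by the orthogonal polar factor. -/
theorem IsThinSVD.eq_polar {n k : ℕ} {B U : Matrix (Fin n) (Fin k) ℝ} {σ : Fin k → ℝ}
    {V : Matrix (Fin k) (Fin k) ℝ} (h : IsThinSVD B U σ V) (hB : B.rank = k) (P : stiefel n k)
    (hP : ((U * Vᵀ)ᵀ * B).trace - (P.1ᵀ * B).trace = 0) : P.1 = U * Vᵀ := by
  -- A vanishing singular value would push the rank of `diagonal σ`, hence of `B`, below `k`.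
  have hσ : ∀ j, σ j ≠ 0 := by
    intro j hj
    have h1 : B.rank ≤ (Matrix.diagonal σ).rank := by
      rw [h.eq]
      exact (Matrix.rank_mul_le_left _ _).trans (Matrix.rank_mul_le_right _ _)
    rw [hB, Matrix.rank_diagonal] at h1
    have h2 := Fintype.card_subtype_lt (p := fun i => σ i ≠ 0) (x := j) (by simpa using hj)
    rw [Fintype.card_fin] at h2
    omega
  have hpos : ∀ j, 0 ≤ ∑ i, ((P.1 * V) i j - U i j) ^ 2 :=
    fun j => Finset.sum_nonneg fun i _ => sq_nonneg _
  rw [h.trace_gap, mul_eq_zero, or_iff_right (by norm_num),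
    Finset.sum_eq_zero_iff_of_nonneg fun j _ => mul_nonneg (h.nonneg j) (hpos j)] at hP
  have hPV : P.1 * V = U := by
    ext i j
    have h1 := (mul_eq_zero.1 (hP j (Finset.mem_univ j))).resolve_left (hσ j)
    rw [Finset.sum_eq_zero_iff_of_nonneg fun i _ => sq_nonneg _] at h1
    exact sub_eq_zero.1 (pow_eq_zero_iff two_ne_zero |>.1 (h1 i (Finset.mem_univ i)))
  have hV : V * Vᵀ = 1 := mul_eq_one_comm.1 h.right_mem
  rw [← hPV, Matrix.mul_assoc, hV, Matrix.mul_one]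

/-! ### Limits of SVDs, compactness and column spaces -/

/-- Expresses `σ` continuously in `B`, `U`, `V`, so that its convergence follows from theirs. -/
theorem IsThinSVD.eq_diag {n k : ℕ} {B U : Matrix (Fin n) (Fin k) ℝ} {σ : Fin k → ℝ}
    {V : Matrix (Fin k) (Fin k) ℝ} (h : IsThinSVD B U σ V) : σ = (Uᵀ * B * V).diag := by
  have hU : Uᵀ * U = 1 := h.left_mem
  have hV : Vᵀ * V = 1 := h.right_mem
  have : Uᵀ * B * V = Matrix.diagonal σ := by
    rw [h.eq, Matrix.mul_assoc, Matrix.mul_assoc, hV, Matrix.mul_one, ← Matrix.mul_assoc, hU,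
      Matrix.one_mul]
  rw [this, Matrix.diag_diagonal]

/-- Every condition in `IsThinSVD` is closed, and the limit of `σ` is supplied by `eq_diag`. -/
theorem isThinSVD_of_tendsto {ι : Type*} {l : Filter ι} [l.NeBot] {n k : ℕ}
    {B U : ι → Matrix (Fin n) (Fin k) ℝ} {σ : ι → Fin k → ℝ} {V : ι → Matrix (Fin k) (Fin k) ℝ}
    {B' U' : Matrix (Fin n) (Fin k) ℝ} {V' : Matrix (Fin k) (Fin k) ℝ}
    (h : ∀ i, IsThinSVD (B i) (U i) (σ i) (V i)) (hB : Tendsto B l (𝓝 B'))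
    (hU : Tendsto U l (𝓝 U')) (hV : Tendsto V l (𝓝 V')) :
    IsThinSVD B' U' (U'ᵀ * B' * V').diag V' := by
  have hσ : Tendsto σ l (𝓝 (U'ᵀ * B' * V').diag) := by
    have hc : Continuous fun x : Matrix (Fin n) (Fin k) ℝ × Matrix (Fin n) (Fin k) ℝ ×
        Matrix (Fin k) (Fin k) ℝ => (x.2.1ᵀ * x.1 * x.2.2).diag := by fun_prop
    have := (hc.tendsto (B', U', V')).comp (hB.prodMk_nhds (hU.prodMk_nhds hV))
    refine this.congr fun i => ?_
    exact (h i).eq_diag.symm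
  have hσ' : ∀ j, Tendsto (fun i => σ i j) l (𝓝 ((U'ᵀ * B' * V').diag j)) :=
    fun j => ((continuous_apply j).tendsto _).comp hσ
  refine ⟨?_, ?_, ?_, ?_, ?_⟩
  · have hc : Continuous fun x : Matrix (Fin n) (Fin k) ℝ => xᵀ * x := by fun_prop
    exact tendsto_nhds_unique (((hc.tendsto U').comp hU).congr fun i => (h i).left_mem)
      tendsto_const_nhds
  · have hc : Continuous fun x : Matrix (Fin k) (Fin k) ℝ => xᵀ * x := by fun_prop
    exact tendsto_nhds_unique (((hc.tendsto V').comp hV).congr fun i => (h i).right_mem)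
      tendsto_const_nhds
  · exact fun a b hab => le_of_tendsto_of_tendsto' (hσ' b) (hσ' a) fun i => (h i).antitone hab
  · exact fun j => ge_of_tendsto' (hσ' j) fun i => (h i).nonneg j
  · have hc : Continuous fun x : Matrix (Fin n) (Fin k) ℝ × (Fin k → ℝ) ×
        Matrix (Fin k) (Fin k) ℝ => x.1 * Matrix.diagonal x.2.1 * x.2.2ᵀ := by fun_prop
    refine tendsto_nhds_unique hB ?_
    refine ((hc.tendsto (U', _, V')).comp (hU.prodMk_nhds (hσ.prodMk_nhds hV))).congr fun i => ?_
    exact (h i).eq.symm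

theorem isCompact_stiefel (n k : ℕ) : IsCompact (stiefel n k) := by
  have hK : IsCompact {X : Matrix (Fin n) (Fin k) ℝ | ∀ i, X i ∈ {r : Fin k → ℝ |
      ∀ j, r j ∈ Set.Icc (-1 : ℝ) 1}} :=
    isCompact_pi_infinite fun _ => isCompact_pi_infinite fun _ => isCompact_Icc
  refine hK.of_isClosed_subset ?_ ?_
  · exact isClosed_eq (by fun_prop) continuous_const
  · intro X hX i j
    have h1 : ∑ i, X i j * X i j = 1 := by
      simpa [Matrix.mul_apply] using congrFun₂ (show Xᵀ * X = 1 from hX) j j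
    have h2 : X i j * X i j ≤ 1 := by
      rw [← h1]
      exact Finset.single_le_sum (f := fun i => X i j * X i j)
        (fun i _ => mul_self_nonneg _) (Finset.mem_univ i)
    exact abs_le.1 (abs_le_one_iff_mul_self_le_one.2 h2)

instance (n k : ℕ) : CompactSpace (stiefel n k) :=
  isCompact_iff_compactSpace.1 (isCompact_stiefel n k)

open scoped Matrix.Norms.L2Operator in
-- In the gap criterion, `Y v` is approximated by `X v`, the same coordinates in the other basis.
theorem dist_colSpan_le {n k : ℕ} (X Y : stiefel n k) :
    dist (colSpan X) (colSpan Y) ≤ ‖Y.1 - X.1‖ := by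
  rw [dist_colSpan, sinThetaNorm_le_iff_gap _ _ (norm_nonneg _)]
  rintro _ ⟨v, rfl⟩
  refine ⟨Matrix.toEuclideanLin X.1 v, ⟨v, rfl⟩, ?_, ?_⟩
  · have h : Matrix.toEuclideanLin Y.1 v - Matrix.toEuclideanLin X.1 v =
        WithLp.toLp 2 ((Y.1 - X.1) *ᵥ v.ofLp) := by
      rw [Matrix.sub_mulVec, WithLp.toLp_sub]
      simp only [Matrix.toLpLin_apply]
    rw [norm_toEuclideanLin Y.2, h]
    exact Matrix.l2_opNorm_mulVec _ v
  · rw [norm_toEuclideanLin X.2, norm_toEuclideanLin Y.2]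

open scoped Matrix.Norms.L2Operator in
theorem continuous_colSpan (n k : ℕ) : Continuous (colSpan : stiefel n k → Grassmannian n k) := by
  refine continuous_iff_continuousAt.2 fun X => tendsto_iff_dist_tendsto_zero.2 ?_
  have hc : Continuous fun Y : stiefel n k => ‖X.1 - Y.1‖ := by fun_prop
  refine squeeze_zero (fun _ => dist_nonneg) (fun Y => dist_colSpan_le Y X) ?_
  simpa using hc.tendsto X

instance (n k : ℕ) : CompactSpace (Grassmannian n k) := by
  refine ⟨?_⟩
  rw [← Set.range_eq_univ.2 (colSpan_surjective (n := n) (k := k))]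
  exact isCompact_range (continuous_colSpan n k)

/-- Two matrices with orthonormal columns span the same subspace exactly when they differ by an
orthogonal matrix. -/
theorem colSpan_eq_iff {n k : ℕ} {X Y : stiefel n k} :
    colSpan Y = colSpan X ↔ ∃ Q ∈ stiefel k k, Y.1 = X.1 * Q := by
  constructor
  · intro h
    have h1 : ∀ j, ∃ w, Matrix.toEuclideanLin X.1 w =
        Matrix.toEuclideanLin Y.1 (EuclideanSpace.single j 1) := fun j => by
      have : Matrix.toEuclideanLin Y.1 (EuclideanSpace.single j 1) ∈ colSpace Y.1 := ⟨_, rfl⟩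
      rwa [show colSpace Y.1 = colSpace X.1 from congrArg Subtype.val h] at this
    choose w hw using h1
    have hY : Y.1 = X.1 * Matrix.of fun i j => w j i := by
      ext i j
      have := congrArg (fun v : EuclideanSpace ℝ (Fin n) => v i) (hw j)
      simpa [Matrix.toLpLin_apply, Matrix.mulVec, dotProduct, Matrix.mul_apply] using this.symm
    refine ⟨_, ?_, hY⟩
    -- Since `XᵀX = 1`, the identity `YᵀY = 1` collapses to `QᵀQ = 1`.
    have hYY : Y.1ᵀ * Y.1 = 1 := Y.2
    rw [hY, transpose_mul, Matrix.mul_assoc, ← Matrix.mul_assoc X.1ᵀ,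
      show X.1ᵀ * X.1 = 1 from X.2, Matrix.one_mul] at hYY
    exact hYY
  · rintro ⟨Q, -, h⟩
    refine Subtype.ext (Submodule.eq_of_le_of_finrank_eq ?_
      ((finrank_colSpace Y.2).trans (finrank_colSpace X.2).symm))
    rintro _ ⟨v, rfl⟩
    exact ⟨Matrix.toEuclideanLin Q v, by rw [h, toEuclideanLin_mul]⟩

/-- A sequence in a compact space converges to an isolated accumulation point if consecutive terms
approach this point together. -/
theorem IsIsolatedAccPt.tendsto {α : Type*} [TopologicalSpace α] [CompactSpace α] [T2Space α]
    {u : ℕ → α} {a : α} (ha : IsIsolatedAccPt u a)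
    (hstep : ∀ l : Ultrafilter ℕ, ↑l ≤ (atTop : Filter ℕ) → Tendsto u l (𝓝 a) →
      Tendsto (fun i => u (i + 1)) l (𝓝 a)) : Tendsto u atTop (𝓝 a) := by
  obtain ⟨hacc, N, hN, hiso⟩ := ha
  -- A closed `K` keeps limits of terms in `K` inside `N`, where `a` is the only possible limit.
  obtain ⟨K, hK, hKc, hKN⟩ := exists_mem_nhds_isClosed_subset hN
  have hlim : ∀ l : Ultrafilter ℕ, ↑l ≤ (atTop : Filter ℕ) → u ⁻¹' K ∈ l →
      Tendsto u l (𝓝 a) := by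
    intro l hl hlK
    obtain ⟨b, -, hb⟩ := isCompact_univ.ultrafilter_le_nhds (l.map u) (by simp)
    have hb : Tendsto u l (𝓝 b) := hb
    have hbK : b ∈ K := hKc.mem_of_tendsto hb hlK
    have hbu : MapClusterPt b atTop u := hb.mapClusterPt.mono hl
    rwa [hiso b (hKN hbK) hbu] at hb
  -- Eventually `K` cannot be left: along an ultrafilter of indices with `u i ∈ K`, `u i` tends to
  -- `a`, hence so does `u (i + 1)`.
  have hev : ∀ᶠ i in atTop, u i ∈ K → u (i + 1) ∈ K := by
    refine mem_iff_ultrafilter.2 fun l hl => ?_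
    by_cases hlK : u ⁻¹' K ∈ l
    · filter_upwards [hstep l hl (hlim l hl hlK) hK] with i hi _ using hi
    · filter_upwards [Ultrafilter.compl_mem_iff_notMem.2 hlK] with i hi hi' using absurd hi' hi
  obtain ⟨m, hm⟩ := eventually_atTop.1 hev
  obtain ⟨j, hj, hjK⟩ := frequently_atTop.1 (hacc.frequently hK) m
  have hall : ∀ i ≥ j, u i ∈ K := fun i hi =>
    Nat.le_induction hjK (fun i hi h => hm i (hj.trans hi) h) i hi
  refine tendsto_iff_ultrafilter _ _ _ |>.2 fun l hl => hlim l hl ?_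
  exact hl (eventually_atTop.2 ⟨j, hall⟩)

/-! ### Asymptotics of one iteration step -/

section SCF

variable {n k : ℕ} {f : Matrix (Fin n) (Fin k) ℝ → ℝ} {S : Set (stiefel n k)} {ω : ℝ}
  {P : ℕ → stiefel n k}

theorem IsSCFSequence.exists_tendsto (hP : IsSCFSequence f S ω P)
    (hf : ContinuousOn f (stiefel n k)) : ∃ L, Tendsto (fun i => f (P i)) atTop (𝓝 L) := by
  refine ⟨_, tendsto_atTop_ciSup (monotone_nat_of_le_succ fun i => ?_) ?_⟩
  · obtain ⟨U, σ, V, Q, hsvd, -, -, -, h⟩ := hP.step i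
    -- The choice `η = 0` is admissible because the trace gap is nonnegative.
    have h1 := h 0 (by linarith [hsvd.trace_gap_nonneg (P i)])
    linarith
  · exact ((isCompact_stiefel n k).bddAbove_image hf).mono
      (Set.range_subset_iff.2 fun i => Set.mem_image_of_mem f (P i).2)

/-- Near an accumulation point at which the gradient has full rank, one step of the iteration
asymptotically changes the iterate only by an orthogonal factor. -/
theorem IsSCFSequence.exists_tendsto_succ (hP : IsSCFSequence f S ω P) (hω : 0 < ω)
    (hf : ContinuousOn f (stiefel n k)) (hgrad : ContinuousOn (gradient f) (stiefel n k))
    {l : Ultrafilter ℕ} (hl : ↑l ≤ (atTop : Filter ℕ)) {X : stiefel n k}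
    (hX : Tendsto P l (𝓝 X)) (hrank : (gradient f X).rank = k) :
    ∃ Y : stiefel n k, colSpan Y = colSpan X ∧ Tendsto (fun i => P (i + 1)) l (𝓝 Y) := by
  choose U σ V Q hsvd hQ hPQ hS hη using hP.step
  have hlim : ∀ {m : ℕ} (A : ℕ → Matrix (Fin m) (Fin k) ℝ), (∀ i, A i ∈ stiefel m k) →
      ∃ A' ∈ stiefel m k, Tendsto A l (𝓝 A') := fun {m} A hA =>
    (isCompact_stiefel m k).ultrafilter_le_nhds (l.map A)
      (le_principal_iff.2 (mem_map.2 (Filter.univ_mem' hA)))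
  obtain ⟨U', -, hU⟩ := hlim U fun i => (hsvd i).left_mem
  obtain ⟨V', -, hV⟩ := hlim V fun i => (hsvd i).right_mem
  obtain ⟨Q', hQ', hQt⟩ := hlim Q hQ
  have hB : Tendsto (fun i => gradient f (P i)) l (𝓝 (gradient f X)) :=
    ((continuousOn_iff_continuous_domRestrict.1 hgrad).tendsto X).comp hX
  have hX' : Tendsto (fun i => (P i).1) l (𝓝 X.1) := (continuous_subtype_val.tendsto X).comp hX
  have hsvd' := isThinSVD_of_tendsto hsvd hB hU hV
  obtain ⟨L, hL⟩ := hP.exists_tendsto hf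
  have hgap0 : Tendsto (fun i => ((U i * (V i)ᵀ)ᵀ * gradient f (P i)).trace -
      ((P i).1ᵀ * gradient f (P i)).trace) atTop (𝓝 0) := by
    have hd : Tendsto (fun i => ω⁻¹ * (f (P (i + 1)) - f (P i))) atTop (𝓝 0) := by
      simpa using ((hL.comp (tendsto_add_atTop_nat 1)).sub hL).const_mul ω⁻¹
    -- Here `η` is the entire gap, the largest value allowed in `(*)`.
    refine squeeze_zero (fun i => (hsvd i).trace_gap_nonneg (P i)) (fun i => ?_) hd
    rw [le_inv_mul_iff₀ hω]
    linarith [hη i _ (add_sub_cancel _ _).le]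
  have hc : Continuous fun x : Matrix (Fin n) (Fin k) ℝ × Matrix (Fin n) (Fin k) ℝ ×
      Matrix (Fin k) (Fin k) ℝ × Matrix (Fin n) (Fin k) ℝ =>
      ((x.2.1 * x.2.2.1ᵀ)ᵀ * x.1).trace - (x.2.2.2ᵀ * x.1).trace := by fun_prop
  -- The gap at `X` relative to the limit factors is the limit of gaps that tend to zero.
  have hgap := tendsto_nhds_unique ((hc.tendsto (_, U', V', X.1)).comp
    (hB.prodMk_nhds (hU.prodMk_nhds (hV.prodMk_nhds hX')))) (hgap0.mono_left hl)
  have hpolar := hsvd'.eq_polar hrank X hgap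
  have hmem : X.1 * Q' ∈ stiefel n k := by
    change (X.1 * Q')ᵀ * (X.1 * Q') = 1
    rw [transpose_mul, Matrix.mul_assoc, ← Matrix.mul_assoc X.1ᵀ, show X.1ᵀ * X.1 = 1 from X.2,
      Matrix.one_mul]
    exact hQ'
  refine ⟨⟨X.1 * Q', hmem⟩, colSpan_eq_iff.2 ⟨Q', hQ', rfl⟩, tendsto_subtype_rng.2 ?_⟩
  have hc' : Continuous fun x : Matrix (Fin n) (Fin k) ℝ × Matrix (Fin k) (Fin k) ℝ ×
      Matrix (Fin k) (Fin k) ℝ => x.1 * x.2.1ᵀ * x.2.2 := by fun_prop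
  -- The next iterate is `U i * (V i)ᵀ * Q i`, with limit `U' * V'ᵀ * Q' = X * Q'`.
  have := (hc'.tendsto (U', V', Q')).comp (hU.prodMk_nhds (hV.prodMk_nhds hQt))
  simp only [← hpolar] at this
  exact this.congr fun i => (hPQ i).symm

end SCF

theorem stiefel_subset_stiefelNhd (n : ℕ) {k : ℕ} (ν : Seminorm ℝ (Matrix (Fin k) (Fin k) ℝ))
    {δ : ℝ} (hδ : 0 < δ) : stiefel n k ⊆ stiefelNhd n ν δ := by
  intro P hP
  change ν (Pᵀ * P - 1) < δ
  rwa [show Pᵀ * P = 1 from hP, sub_self, map_zero]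

end NPDo

theorem mainTheorem3 (n k : ℕ) (hk : 1 ≤ k) (hkn : k ≤ n)
    (ν : Seminorm ℝ (Matrix (Fin k) (Fin k) ℝ)) (hν : ∀ A, ν A = 0 → A = 0)
    (δ : ℝ) (hδ : 0 < δ)
    (f : Matrix (Fin n) (Fin k) ℝ → ℝ)
    (hf : DifferentiableOn ℝ f (NPDo.stiefelNhd n ν δ))
    (hgrad : ContinuousOn (NPDo.gradient f) (NPDo.stiefel n k))
    (S : Set (NPDo.stiefel n k)) (ω : ℝ) (hω : 0 < ω)
    (hAnsatz : NPDo.Ansatz f S ω)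
    (P : ℕ → NPDo.stiefel n k) (hP : NPDo.IsSCFSequence f S ω P)
    (Pstar : NPDo.stiefel n k) (hPstar : MapClusterPt Pstar atTop P) :
    MapClusterPt (NPDo.colSpan Pstar) atTop (fun i => NPDo.colSpan (P i)) ∧
    (NPDo.IsIsolatedAccPt (fun i => NPDo.colSpan (P i)) (NPDo.colSpan Pstar) →
      (∀ Q ∈ NPDo.stiefel k k, (NPDo.gradient f (Pstar.1 * Q)).rank = k) →
      Tendsto (fun i => NPDo.colSpan (P i)) atTop (𝓝 (NPDo.colSpan Pstar))) ∧
    (NPDo.IsIsolatedAccPt P Pstar →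
      (NPDo.gradient f Pstar).rank = k →
      (∀ R : NPDo.stiefel n k, R ≠ Pstar → NPDo.colSpan R = NPDo.colSpan Pstar →
        f Pstar > f R) →
      Tendsto P atTop (𝓝 Pstar)) := by
  have hfc : ContinuousOn f (NPDo.stiefel n k) :=
    hf.continuousOn.mono (NPDo.stiefel_subset_stiefelNhd n ν hδ)
  refine ⟨hPstar.continuousAt_comp (NPDo.continuous_colSpan n k).continuousAt, ?_, ?_⟩
  · intro hiso hrank
    refine hiso.tendsto fun l hl hlim => ?_
    -- Only the column spaces are known to tend to that of `Pstar`; the iterates themselves tend to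
    -- some `X = Pstar * Q`, hence the rank condition for every `Q`.
    obtain ⟨X, -, hX⟩ := isCompact_univ.ultrafilter_le_nhds (l.map P) (by simp)
    have hXspan : NPDo.colSpan X = NPDo.colSpan Pstar :=
      tendsto_nhds_unique (((NPDo.continuous_colSpan n k).tendsto X).comp hX) hlim
    obtain ⟨Q, hQ, hXQ⟩ := NPDo.colSpan_eq_iff.1 hXspan
    obtain ⟨Y, hY, hYlim⟩ := hP.exists_tendsto_succ hω hfc hgrad hl hX (hXQ ▸ hrank Q hQ)
    rw [← hXspan, ← hY]
    exact ((NPDo.continuous_colSpan n k).tendsto Y).comp hYlim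
  · intro hiso hrank hmax
    refine hiso.tendsto fun l hl hlim => ?_
    obtain ⟨Y, hY, hYlim⟩ := hP.exists_tendsto_succ hω hfc hgrad hl hlim hrank
    obtain ⟨L, hL⟩ := hP.exists_tendsto hfc
    have hfr := continuousOn_iff_continuous_domRestrict.1 hfc
    -- Both limits carry the value `L` of the convergent sequence `f (P i)`, which leaves `Y` no
    -- room to differ from the strict maximizer.
    have h1 : f Pstar = L :=
      tendsto_nhds_unique ((hfr.tendsto Pstar).comp hlim) (hL.mono_left hl)
    have h2 : f Y = L := tendsto_nhds_unique ((hfr.tendsto Y).comp hYlim)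
      ((hL.comp (tendsto_add_atTop_nat 1)).mono_left hl)
    have hYP : Y = Pstar := by
      by_contra hne
      exact (hmax Y hne hY).ne (h2.trans h1.symm)
    rwa [hYP] at hYlim
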